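/- **Setting.** Let $X,Z$ be the single-qubit Pauli matrices. For $a\in\mathbb Z_2^{2n}$ let $P_a=\bigotimes_{k=1}^n i^{a_{x,k}a_{z,k}}X^{a_{x,k}}Z^{a_{z,k}}$ be the corresponding $n$-qubit Pauli operator. An $n$-qubit Pauli channel is a map $\Lambda(\rho)=\sum_a p_aP_a\rho P_a$ with $p_a\ge 0$ and $\sum_a p_a=1$; its Pauli eigenvalues are $\lambda_a=2^{-n}\operatorname{Tr}[P_a\Lambda(P_a)]$. A *classical-memory-assisted (entanglement-free) scheme* using $N\ge1$ copies of $\Lambda$ consists of: - classical registers with finite, arbitrarily large alphabets, with contents $o_0,\dots,o_N$; - an ensemble of positive semidefinite operators $\rho_{o_0}$ on the $n$-qubit space with $\sum_{o_0}\operatorname{Tr}\rho_{o_0}=1$; - for $1\le t\le N-1$ and every history $o_{<t}=(o_0,\dots,o_{t-1})$, a quantum instrument $\{\mathcal C^{o_{<t}}_{o_t}\}_{o_t}$ on the $n$-qubit system, i.e. completely positive maps whose sum over $o_t$ is trace preserving; - for every history $o_{<N}$, a final POVM $\{E^{o_{<N}}_{o_N}\}_{o_N}$. When the unknown channel is $\Lambda$,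 the outcome sequence $o=(o_0,\dots,o_N)$ has probability $$\Pr[o\mid\Lambda]=\operatorname{Tr}\Bigl[E^{o_{<N}}_{o_N}\bigl(\Lambda\circ\mathcal C^{o_{<N-1}}_{o_{N-1}}\circ\cdots\circ\Lambda\circ\mathcal C^{o_{<1}}_{o_1}\circ\Lambda\bigr)(\rho_{o_0})\Bigr].$$ An instrument is *trivial* if each of its maps is proportional to a completely positive trace-preserving map; a POVM is trivial if each of its elements is proportional to the identity. The *number of measurements* $N_{\mathrm{meas}}$ of the scheme is the maximum, over all outcome sequences $o$ that have positive probability for some Pauli channel, of the number of non-trivial measurements among the $N-1$ instruments and the final POVM used along $o$. In particular $N_{\mathrm{meas}}\le N$. **Theorem.** Let $n\ge 0$ and $0<\varepsilon\le 1/6$. Suppose that there are a classical-memory-assisted scheme using $N$ copies and estimators $\widehat\lambda_a$ ($a\in\mathbb Z_2^{2n}$), real functions of the outcome sequence $o$, such that for every $n$-qubit Pauli channel $\Lambda$ and every $a$, $$\Pr\bigl[\,|\widehat\lambda_a-\lambda_a|\le\varepsilon\,\big|\,\Lambda\bigr]\ge\tfrac23 .$$ Then $$N\ \ge\ N_{\mathrm{meas}}\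 \ge\ 0.005\cdot\frac{4^n-1}{2^n\varepsilon^2}.$$ Consequently there is a universal constant $c>0$ such that, for all $n\ge1$, every such scheme satisfies $N\ge N_{\mathrm{meas}}\ge c\,2^n/\varepsilon^2$; that is, both are $\Omega(2^n/\varepsilon^2)$. -/

import Mathlib

noncomputable section

namespace PauliLearning

open scoped ComplexOrder MatrixOrder Matrix.Norms.L2Operator CStarAlgebra

/-- Operators on the `n`-qubit Hilbert space `(ℂ²)^{⊗ n}`, as matrices in the computational basis
of bit strings `Fin n → Fin 2`. With the scoped instances opened above, this type carries the
L2-operator norm, the C⋆-algebra structure and the Loewner order (`0 ≤ A` iff `A.PosSemidef`). -/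
abbrev Op (n : ℕ) : Type := Matrix (Fin n → Fin 2) (Fin n → Fin 2) ℂ

/-! ### Pauli operators and Pauli channels -/

/-- Labels of `n`-qubit Pauli operators: `a k = (a_{x,k}, a_{z,k})`, i.e. elements of `ℤ₂^{2n}`. -/
abbrev PauliIdx (n : ℕ) : Type := Fin n → ZMod 2 × ZMod 2

/-- The single-qubit operator `i^{xz} X^x Z^z`. -/
def pauli₁ (b : ZMod 2 × ZMod 2) : Matrix (Fin 2) (Fin 2) ℂ :=
  Complex.I ^ (b.1.val * b.2.val) • (!![0, 1; 1, 0] ^ b.1.val * !![1, 0; 0, -1] ^ b.2.val)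

/-- The `n`-qubit Pauli operator `P_a = ⨂ₖ i^{a_{x,k} a_{z,k}} X^{a_{x,k}} Z^{a_{z,k}}`. -/
def pauli {n : ℕ} (a : PauliIdx n) : Op n :=
  Matrix.of fun x y => ∏ k, pauli₁ (a k) (x k) (y k)

/-- The map `ρ ↦ ∑ₐ pₐ Pₐ ρ Pₐ`; a Pauli channel when the error rates `p` form a probability
vector. -/
def pauliMap {n : ℕ} (p : PauliIdx n → ℝ) (ρ : Op n) : Op n :=
  ∑ a, (p a : ℂ) • (pauli a * ρ * pauli a)

/-- `Λ` is an `n`-qubit Pauli channel. -/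
def IsPauliChannel {n : ℕ} (Λ : Op n → Op n) : Prop :=
  ∃ p ∈ stdSimplex ℝ (PauliIdx n), Λ = pauliMap p

/-- The Pauli eigenvalue (Pauli fidelity) `λ_a = Tr[P_a Λ(P_a)] / 2^n`; it is a real number for
every Pauli channel. -/
def pauliEigenvalue {n : ℕ} (Λ : Op n → Op n) (a : PauliIdx n) : ℝ :=
  ((pauli a * Λ (pauli a)).trace / 2 ^ n).re

/-! ### Instruments and POVMs with finitely many outcomes -/

/-- The completely positive maps `C o` form a quantum instrument: `ρ ↦ ∑ₒ |o⟩⟨o| ⊗ C o ρ` is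
trace preserving. (Each `C o` is then automatically trace non-increasing.) -/
def IsInstrument {n : ℕ} {A : Type} [Fintype A] (C : A → (Op n →CP Op n)) : Prop :=
  ∀ ρ : Op n, ∑ o, (C o ρ).trace = ρ.trace

/-- An instrument is trivial if each of its maps is proportional to a quantum channel (a completely
positive trace-preserving map). -/
def IsTrivialInstrument {n : ℕ} {A : Type} (C : A → (Op n →CP Op n)) : Prop :=
  ∀ o, ∃ (c : ℝ) (Φ : Op n →CP Op n),
    (∀ ρ, (Φ ρ).trace = ρ.trace) ∧ ∀ ρ, C o ρ = (c : ℂ) • Φ ρ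

/-- `E` is a positive-operator-valued measure. -/
def IsPOVM {n : ℕ} {A : Type} [Fintype A] (E : A → Op n) : Prop :=
  (∀ o, (E o).PosSemidef) ∧ ∑ o, E o = 1

/-- A POVM is trivial if each of its elements is proportional to the identity, i.e. each
`ρ ↦ Tr[E o ρ]` is proportional to the trace. -/
def IsTrivialPOVM {n : ℕ} {A : Type} (E : A → Op n) : Prop :=
  ∀ o, ∃ c : ℝ, E o = (c : ℂ) • (1 : Op n)

/-! ### Classical-memory-assisted schemes -/

/-- Contents `(o_0, …, o_{t-1})` of the first `t` classical registers. -/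
abbrev Hist (A : ℕ → Type) (t : ℕ) : Type := (k : Fin t) → A k

/-- A classical-memory-assisted scheme on `n` qubits with `m` intermediate instruments; it uses
`m + 1` copies of the unknown channel.

Register `0` records the label of the initial state, register `t + 1` (`t < m`) records the outcome
of the `(t + 1)`-st instrument, and register `m + 1` records the outcome of the final POVM.
Each instrument and the POVM may depend on the contents of all earlier registers. Only the registers
with index at most `m + 1` and the instruments `instr t` with `t < m` are ever used. -/
structure Scheme (n m : ℕ) where
  /-- the alphabets of the classical registers, finite but arbitrarily large -/
  A : ℕ → Type
  [fin : ∀ t, Fintype (A t)]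
  /-- the ensemble of sub-normalized initial states -/
  init : A 0 → Op n
  init_posSemidef : ∀ o, (init o).PosSemidef
  init_trace : ∑ o, (init o).trace = 1
  /-- the adaptively chosen instruments between consecutive copies of the channel -/
  instr : (t : ℕ) → Hist A (t + 1) → A (t + 1) → (Op n →CP Op n)
  instr_isInstrument : ∀ t < m, ∀ h, IsInstrument (instr t h)
  /-- the adaptively chosen final measurement -/
  povm : Hist A (m + 1) → A (m + 1) → Op n
  povm_isPOVM : ∀ h, IsPOVM (povm h)

attribute [instance] Scheme.fin

namespace Scheme

variable {n m : ℕ} (S : Scheme n m)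

/-- Complete outcome sequences `(o_0, …, o_{m+1})`. -/
abbrev Outcome : Type := Hist S.A (m + 2)

/-- The number of copies of the unknown channel used by the scheme. -/
def numCopies (_S : Scheme n m) : ℕ := m + 1

/-- The unnormalized state fed into the `(t + 1)`-st copy of `Λ` after `(o_0, …, o_t)` has been
recorded: `(C_{o_t} ∘ Λ ∘ ⋯ ∘ C_{o_1} ∘ Λ)(ρ_{o_0})`. -/
def state (Λ : Op n → Op n) : (t : ℕ) → Hist S.A (t + 1) → Op n
  | 0, h => S.init (h 0)
  | t + 1, h =>
      S.instr t (fun k => h k.castSucc) (h (Fin.last (t + 1)))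
        (Λ (state Λ t fun k => h k.castSucc))

/-- The probability `Pr[o | Λ]` of the outcome sequence `o` when the unknown channel is `Λ`. -/
def prob (Λ : Op n → Op n) (o : S.Outcome) : ℝ :=
  (S.povm (fun k => o k.castSucc) (o (Fin.last (m + 1))) *
    Λ (S.state Λ m fun k => o k.castSucc)).trace.re

open Classical in
/-- The number of non-trivial measurements made along the outcome sequence `o`, where the final
POVM counts if it is non-trivial. -/
def measCount (o : S.Outcome) : ℕ :=
  (Finset.univ.filter fun t : Fin m =>
      ¬ IsTrivialInstrument
        (S.instr t fun k => o (k.castLE (Nat.succ_le_succ (t.isLt.le.trans (Nat.le_succ m)))))).card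
    + if IsTrivialPOVM (S.povm fun k => o k.castSucc) then 0 else 1

open Classical in
/-- The number of measurements `N_meas` of the scheme: the largest number of non-trivial
measurements made along an outcome sequence that can occur, i.e. that has positive probability for
some Pauli channel. -/
def numMeas : ℕ :=
  (Finset.univ.filter fun o : S.Outcome => ∃ Λ, IsPauliChannel Λ ∧ 0 < S.prob Λ o).sup S.measCount

open Classical in
/-- The scheme together with the classical post-processing `est` estimates every single Pauli
eigenvalue of every Pauli channel to within `ε` with probability at least `2/3`. -/
def Learns (est : S.Outcome → PauliIdx n → ℝ) (ε : ℝ) : Prop :=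
  ∀ Λ : Op n → Op n, IsPauliChannel Λ → ∀ a : PauliIdx n,
    2 / 3 ≤ ∑ o ∈ Finset.univ.filter fun o : S.Outcome =>
      |est o a - pauliEigenvalue Λ a| ≤ ε, S.prob Λ o

end Scheme

end PauliLearning

end

/-! Compare the completely depolarizing channel with the channels whose only nontrivial Pauli
eigenvalue is `λ_a = ±θ`, where `ε < θ < 1` and `a ≠ 0`. An estimator of accuracy `ε` separates the
two signs, so along every `a ≠ 0` the relative entropies from the depolarizing statistics to the two
perturbed ones add up to a constant.

Conversely, every use of the depolarizing channel erases the state, so by the chain rule the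
relative entropy is a sum over rounds in which the system is maximally mixed under the one
hypothesis and equal to `2⁻ⁿ (1 + s P_a)`, with `|s| ≤ θ`, under the other. Measuring the effects
`F_o` of the next instrument or POVM costs at most `θ² / (1 - θ)` times
`∑_o 2⁻ⁿ Tr[F_o P_a]² / Tr F_o`, by the bound through the `χ²`-divergence. By Parseval,
`∑_a Tr[F P_a]² = 2ⁿ Tr[F²] ≤ 2ⁿ Tr[F]²`, so summed over `a` one measurement yields at most
`∑_o Tr F_o = 2ⁿ`, and a trivial one yields nothing for `a ≠ 0`. Since there are `4ⁿ - 1` labels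
`a ≠ 0` to serve, the number of nontrivial measurements is at least of order
`(4ⁿ - 1) / (2ⁿ θ²)`; let `θ` tend to `ε`.
-/

noncomputable section

namespace PauliLearning

open scoped ComplexOrder MatrixOrder Matrix.Norms.L2Operator CStarAlgebra

/-! ### Relative entropy on finite types -/

section RelativeEntropy

variable {Ω : Type*} [Fintype Ω]

/-- The relative entropy (Kullback–Leibler divergence) of two weight functions on a finite type, as
a real number. Where `q o = 0 < p o` the summand has the junk value `0` instead of `∞`, so the
results below assume that `q o = 0` implies `p o = 0`. -/
def relEntropy (p q : Ω → ℝ) : ℝ := ∑ o, p o * Real.log (p o / q o)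

theorem relEntropy_self (p : Ω → ℝ) : relEntropy p p = 0 := by
  refine Finset.sum_eq_zero fun o _ => ?_
  rcases eq_or_ne (p o) 0 with h | h <;> simp [h]

theorem relEntropy_comp_equiv {Ω' : Type*} [Fintype Ω'] (e : Ω' ≃ Ω) (p q : Ω → ℝ) :
    relEntropy (p ∘ e) (q ∘ e) = relEntropy p q :=
  e.sum_comp fun o => p o * Real.log (p o / q o)

theorem relEntropy_le_chiSq {p q : Ω → ℝ} (hp : ∀ o, 0 ≤ p o) (hq : ∀ o, 0 ≤ q o)
    (hpq : ∀ o, q o = 0 → p o = 0) (hsum : ∑ o, p o ≤ ∑ o, q o) :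
    relEntropy p q ≤ ∑ o, (p o - q o) ^ 2 / q o := by
  have hterm (o : Ω) : p o * Real.log (p o / q o) ≤ (p o - q o) + (p o - q o) ^ 2 / q o := by
    rcases (hq o).eq_or_lt' with hq0 | hq0
    · simp [hq0, hpq o hq0]
    have hrhs : (p o - q o) + (p o - q o) ^ 2 / q o = p o * (p o / q o - 1) := by
      field_simp
      ring
    rw [hrhs]
    rcases (hp o).eq_or_lt' with hp0 | hp0
    · simp [hp0]
    · exact mul_le_mul_of_nonneg_left (Real.log_le_sub_one_of_pos (div_pos hp0 hq0)) hp0.le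
  calc relEntropy p q ≤ ∑ o, ((p o - q o) + (p o - q o) ^ 2 / q o) :=
        Finset.sum_le_sum fun o _ => hterm o
    _ = (∑ o, p o - ∑ o, q o) + ∑ o, (p o - q o) ^ 2 / q o := by
        rw [Finset.sum_add_distrib, Finset.sum_sub_distrib]
    _ ≤ ∑ o, (p o - q o) ^ 2 / q o := by linarith

theorem sum_mul_one_add_log_sub_le_relEntropy {p q w : Ω → ℝ} (hp : ∀ o, 0 ≤ p o)
    (hq : ∀ o, 0 ≤ q o) (hpq : ∀ o, q o = 0 → p o = 0) (hw : ∀ o, 0 < w o) :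
    ∑ o, (p o * (1 + Real.log (w o)) - q o * w o) ≤ relEntropy p q := by
  refine Finset.sum_le_sum fun o _ => ?_
  rcases (hp o).eq_or_lt' with hp0 | hp0
  · simpa [hp0] using mul_nonneg (hq o) (hw o).le
  have hq0 : 0 < q o := (hq o).lt_of_ne' fun h => hp0.ne' (hpq o h)
  have hlog := Real.log_le_sub_one_of_pos (div_pos (hw o) (div_pos hp0 hq0))
  rw [Real.log_div (hw o).ne' (div_pos hp0 hq0).ne'] at hlog
  calc p o * (1 + Real.log (w o)) - q o * w o
      = p o * (Real.log (w o) - (w o / (p o / q o) - 1)) := by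
        field_simp
        ring
    _ ≤ p o * Real.log (p o / q o) := mul_le_mul_of_nonneg_left (by linarith) hp0.le

theorem sum_finset_add_sum_compl_le_relEntropy [DecidableEq Ω] {p q : Ω → ℝ} (hp : ∀ o, 0 ≤ p o)
    (hq : ∀ o, 0 ≤ q o) (hpq : ∀ o, q o = 0 → p o = 0) (G : Finset Ω) {α β : ℝ} (hα : 0 < α)
    (hβ : 0 < β) :
    (∑ o ∈ G, p o) * (1 + Real.log α) - (∑ o ∈ G, q o) * α
      + ((∑ o ∈ Gᶜ, p o) * (1 + Real.log β) - (∑ o ∈ Gᶜ, q o) * β) ≤ relEntropy p q := by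
  refine le_of_eq_of_le ?_ (sum_mul_one_add_log_sub_le_relEntropy hp hq hpq
    (w := fun o => if o ∈ G then α else β) fun o => by positivity)
  simp only [Finset.sum_mul, ← Finset.sum_sub_distrib]
  rw [← Finset.sum_add_sum_compl G]
  congr 1 <;> refine Finset.sum_congr rfl fun o ho => ?_
  · rw [if_pos ho]
  · rw [if_neg (Finset.mem_compl.mp ho)]

/-- The weights `(1 + δ)⁻¹` and `(1 - δ)⁻¹` are the likelihood ratios of a fair coin against the
two coins of bias `±δ`, the extremal case. -/
theorem sq_le_relEntropy_add_relEntropy {p q r : Ω → ℝ} (hp : p ∈ stdSimplex ℝ Ω)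
    (hq : q ∈ stdSimplex ℝ Ω) (hr : r ∈ stdSimplex ℝ Ω) (hpq : ∀ o, q o = 0 → p o = 0)
    (hpr : ∀ o, r o = 0 → p o = 0) (G : Finset Ω) {δ : ℝ} (hδ₀ : 0 ≤ δ) (hδ₁ : δ < 1)
    (hG : δ ≤ ∑ o ∈ G, q o - ∑ o ∈ G, r o) :
    δ ^ 2 ≤ relEntropy p q + relEntropy p r := by
  classical
  have hα : 0 < 1 + δ := by linarith
  have hβ : 0 < 1 - δ := by linarith
  have hDq :=
    sum_finset_add_sum_compl_le_relEntropy hp.1 hq.1 hpq G (inv_pos.mpr hα) (inv_pos.mpr hβ)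
  have hDr :=
    sum_finset_add_sum_compl_le_relEntropy hp.1 hr.1 hpr G (inv_pos.mpr hβ) (inv_pos.mpr hα)
  have hpc := (Finset.sum_add_sum_compl G p).trans hp.2
  have hqc := (Finset.sum_add_sum_compl G q).trans hq.2
  have hrc := (Finset.sum_add_sum_compl G r).trans hr.2
  rw [← eq_sub_iff_add_eq'] at hpc hqc hrc
  rw [hpc, hqc, Real.log_inv, Real.log_inv] at hDq
  rw [hpc, hrc, Real.log_inv, Real.log_inv] at hDr
  set d := ∑ o ∈ G, q o - ∑ o ∈ G, r o with hd
  have hlog : Real.log (1 + δ) + Real.log (1 - δ) ≤ -δ ^ 2 := by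
    rw [← Real.log_mul hα.ne' hβ.ne']
    linarith [Real.log_le_sub_one_of_pos (mul_pos hα hβ)]
  have hmass : (1 + d) * (1 + δ)⁻¹ + (1 - d) * (1 - δ)⁻¹ ≤ 2 := by
    rw [← div_eq_mul_inv, ← div_eq_mul_inv, div_add_div _ _ hα.ne' hβ.ne',
      div_le_iff₀ (mul_pos hα hβ)]
    nlinarith [mul_nonneg hδ₀ (sub_nonneg.mpr hG)]
  rw [hd] at hmass
  linarith

theorem relEntropy_prod {H A : Type*} [Fintype H] [Fintype A] {u v : H → ℝ} {P Q : H → A → ℝ}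
    (huv : ∀ h, v h = 0 → u h = 0) (hPQ : ∀ h o, Q h o = 0 → P h o = 0)
    (hP : ∀ h, ∑ o, P h o = 1) :
    relEntropy (fun x : H × A => u x.1 * P x.1 x.2) (fun x => v x.1 * Q x.1 x.2)
      = relEntropy u v + ∑ h, u h * relEntropy (P h) (Q h) := by
  have hterm (h : H) (o : A) : u h * P h o * Real.log (u h * P h o / (v h * Q h o))
      = P h o * (u h * Real.log (u h / v h)) + u h * (P h o * Real.log (P h o / Q h o)) := by
    rcases eq_or_ne (u h) 0 with hu | hu
    · simp [hu]
    rcases eq_or_ne (P h o) 0 with hPo | hPo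
    · simp [hPo]
    have hv : v h ≠ 0 := mt (huv h) hu
    have hQ : Q h o ≠ 0 := mt (hPQ h o) hPo
    rw [mul_div_mul_comm, Real.log_mul (div_ne_zero hu hv) (div_ne_zero hPo hQ)]
    ring
  simp only [relEntropy, Fintype.sum_prod_type, hterm, Finset.sum_add_distrib, ← Finset.sum_mul,
    ← Finset.mul_sum, hP, one_mul]

end RelativeEntropy

/-! ### Positive semidefinite matrices -/

section PosSemidef

variable {ι : Type*} [Fintype ι] {A B U : Matrix ι ι ℂ}

theorem coe_re_trace_mul_of_isHermitian (hA : A.IsHermitian) (hB : B.IsHermitian) :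
    ((A * B).trace.re : ℂ) = (A * B).trace := by
  refine Complex.conj_eq_iff_re.mp ?_
  rw [starRingEnd_apply, ← Matrix.trace_conjTranspose, Matrix.conjTranspose_mul, hA.eq, hB.eq,
    Matrix.trace_mul_comm]

theorem coe_re_trace_of_isHermitian (hA : A.IsHermitian) : (A.trace.re : ℂ) = A.trace := by
  classical
  simpa only [mul_one] using coe_re_trace_mul_of_isHermitian hA Matrix.isHermitian_one

theorem re_trace_nonneg_of_posSemidef (hA : A.PosSemidef) : 0 ≤ A.trace.re :=
  (Complex.nonneg_iff.mp hA.trace_nonneg).1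

theorem trace_mul_nonneg_of_posSemidef (hA : A.PosSemidef) (hB : B.PosSemidef) :
    0 ≤ (A * B).trace := by
  classical
  obtain ⟨C, rfl⟩ := CStarAlgebra.nonneg_iff_eq_star_mul_self.mp hB.nonneg
  rw [Matrix.star_eq_conjTranspose, ← mul_assoc, Matrix.trace_mul_comm, ← mul_assoc]
  exact (hA.mul_mul_conjTranspose_same C).trace_nonneg

theorem apply_mul_apply_le_of_posSemidef {κ : Type*} {M : Matrix κ κ ℂ} (hM : M.PosSemidef)
    (i j : κ) : M i j * M j i ≤ M i i * M j j := by
  have hminor := (hM.submatrix ![i, j]).det_nonneg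
  rw [Matrix.det_fin_two] at hminor
  exact sub_nonneg.mp hminor

theorem trace_mul_self_le_of_posSemidef (hA : A.PosSemidef) : (A * A).trace ≤ A.trace ^ 2 := by
  simp only [Matrix.trace, Matrix.diag, Matrix.mul_apply, sq, Finset.sum_mul_sum]
  exact Finset.sum_le_sum fun i _ => Finset.sum_le_sum fun j _ =>
    apply_mul_apply_le_of_posSemidef hA i j

theorem posSemidef_one_add_of_mul_self_eq_one [DecidableEq ι] (hU : U.IsHermitian)
    (hU₂ : U * U = 1) : (1 + U).PosSemidef := by
  have hsq : 1 + U = (1 / 2 : ℝ) • ((1 + U).conjTranspose * (1 + U)) := by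
    rw [Matrix.conjTranspose_add, Matrix.conjTranspose_one, hU.eq]
    simp only [mul_add, add_mul, one_mul, mul_one, hU₂]
    module
  rw [hsq]
  exact (Matrix.posSemidef_conjTranspose_mul_self _).smul (by norm_num)

theorem neg_re_trace_le_re_trace_mul [DecidableEq ι] (hA : A.PosSemidef) (hU : U.IsHermitian)
    (hU₂ : U * U = 1) : -A.trace.re ≤ (A * U).trace.re := by
  have h := (Complex.nonneg_iff.mp (trace_mul_nonneg_of_posSemidef hA
    (posSemidef_one_add_of_mul_self_eq_one hU hU₂))).1
  rw [mul_add, mul_one, Matrix.trace_add, Complex.add_re] at h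
  linarith

theorem abs_re_trace_mul_le_re_trace [DecidableEq ι] (hA : A.PosSemidef) (hU : U.IsHermitian)
    (hU₂ : U * U = 1) : |(A * U).trace.re| ≤ A.trace.re := by
  have hneg := neg_re_trace_le_re_trace_mul hA hU.neg (by rwa [neg_mul_neg])
  rw [mul_neg, Matrix.trace_neg, Complex.neg_re, neg_le_neg_iff] at hneg
  exact abs_le.mpr ⟨neg_re_trace_le_re_trace_mul hA hU hU₂, hneg⟩

end PosSemidef

/-! ### Algebra of Pauli operators -/

section Tensor

variable {ι κ R : Type*} [Fintype ι] [CommSemiring R]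

/-- The tensor product `⨂ₖ M k` of square matrices over a common index type `κ`, indexed by words
`ι → κ`. -/
def tensor (M : ι → Matrix κ κ R) : Matrix (ι → κ) (ι → κ) R :=
  Matrix.of fun x y => ∏ k, M k (x k) (y k)

theorem tensor_mul [DecidableEq ι] [Fintype κ] (M M' : ι → Matrix κ κ R) :
    tensor M * tensor M' = tensor fun k => M k * M' k := by
  ext x y
  simp only [tensor, Matrix.mul_apply, Matrix.of_apply, ← Finset.prod_mul_distrib]
  exact (Fintype.prod_sum fun k j => M k (x k) j * M' k j (y k)).symm

theorem tensor_smul (c : ι → R) (M : ι → Matrix κ κ R) :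
    (tensor fun k => c k • M k) = (∏ k, c k) • tensor M := by
  ext x y
  simp only [tensor, Matrix.of_apply, Matrix.smul_apply, smul_eq_mul, Finset.prod_mul_distrib]

theorem tensor_one [DecidableEq κ] : tensor (fun _ : ι => (1 : Matrix κ κ R)) = 1 := by
  ext x y
  simp only [tensor, Matrix.of_apply, Matrix.one_apply, Fintype.prod_ite_zero,
    Finset.prod_const_one, funext_iff]

theorem conjTranspose_tensor [StarRing R] (M : ι → Matrix κ κ R) :
    (tensor M).conjTranspose = tensor fun k => (M k).conjTranspose := by
  ext x y
  simp only [tensor, Matrix.conjTranspose_apply, Matrix.of_apply, star_prod]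

theorem trace_tensor [DecidableEq ι] [Fintype κ] (M : ι → Matrix κ κ R) :
    (tensor M).trace = ∏ k, (M k).trace := by
  simp only [tensor, Matrix.trace, Matrix.diag, Matrix.of_apply]
  exact (Fintype.prod_sum fun k j => M k j j).symm

end Tensor

theorem forall_pauli₁ {p : ZMod 2 × ZMod 2 → Prop} (h00 : p (0, 0)) (h01 : p (0, 1))
    (h10 : p (1, 0)) (h11 : p (1, 1)) (b : ZMod 2 × ZMod 2) : p b := by
  obtain ⟨x, z⟩ := b
  fin_cases x <;> fin_cases z <;> assumption

theorem pauli₁_zero_zero : pauli₁ (0, 0) = 1 := by simp [pauli₁]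

theorem pauli₁_zero_one : pauli₁ (0, 1) = !![1, 0; 0, -1] := by simp [pauli₁, ZMod.val_one]

theorem pauli₁_one_zero : pauli₁ (1, 0) = !![0, 1; 1, 0] := by simp [pauli₁, ZMod.val_one]

theorem pauli₁_one_one : pauli₁ (1, 1) = !![0, -Complex.I; Complex.I, 0] := by
  simp [pauli₁, ZMod.val_one]

theorem pauli₁_mul_self (b : ZMod 2 × ZMod 2) : pauli₁ b * pauli₁ b = 1 := by
  induction b using forall_pauli₁ <;>
    simp [pauli₁_zero_zero, pauli₁_zero_one, pauli₁_one_zero, pauli₁_one_one, Matrix.one_fin_two]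

theorem conjTranspose_pauli₁ (b : ZMod 2 × ZMod 2) : (pauli₁ b).conjTranspose = pauli₁ b := by
  induction b using forall_pauli₁ <;> ext i j <;> fin_cases i <;> fin_cases j <;>
    simp [pauli₁_zero_zero, pauli₁_zero_one, pauli₁_one_zero, pauli₁_one_one]

theorem trace_pauli₁ {b : ZMod 2 × ZMod 2} (hb : b ≠ 0) : (pauli₁ b).trace = 0 := by
  revert hb
  induction b using forall_pauli₁ <;>
    simp [pauli₁_zero_one, pauli₁_one_zero, pauli₁_one_one, Matrix.trace]

/-- The sign `±1` by which two single-qubit Pauli operators commute, given by the symplectic form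
on `ℤ₂²`. -/
def commSign₁ (b c : ZMod 2 × ZMod 2) : ℝ := (-1) ^ (b.1 * c.2 + b.2 * c.1).val

theorem pauli₁_mul_pauli₁_mul_pauli₁ (b c : ZMod 2 × ZMod 2) :
    pauli₁ b * pauli₁ c * pauli₁ b = (commSign₁ b c : ℂ) • pauli₁ c := by
  induction b using forall_pauli₁ <;> induction c using forall_pauli₁ <;>
    simp [commSign₁, pauli₁_zero_zero, pauli₁_zero_one, pauli₁_one_zero, pauli₁_one_one,
      Matrix.one_fin_two, ZMod.val_one, CharTwo.add_self_eq_zero]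

/-- Equivalently, `∑_b P_b ⊗ P_b` is twice the swap operator. -/
theorem sum_pauli₁_apply_mul_apply (x y z w : Fin 2) :
    ∑ b, pauli₁ b x y * pauli₁ b z w = if x = w ∧ y = z then 2 else 0 := by
  have hsum (f : ZMod 2 × ZMod 2 → ℂ) :
      ∑ b, f b = f (0, 0) + f (0, 1) + (f (1, 0) + f (1, 1)) := by
    rw [Fintype.sum_prod_type]
    exact (Fin.sum_univ_two _).trans (congrArg₂ _ (Fin.sum_univ_two _) (Fin.sum_univ_two _))
  rw [hsum, pauli₁_zero_zero, pauli₁_zero_one, pauli₁_one_zero, pauli₁_one_one]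
  fin_cases x <;> fin_cases y <;> fin_cases z <;> fin_cases w <;> norm_num

variable {n : ℕ}

theorem pauli_eq_tensor (a : PauliIdx n) : pauli a = tensor fun k => pauli₁ (a k) := rfl

theorem pauli_mul_self (a : PauliIdx n) : pauli a * pauli a = 1 := by
  simp only [pauli_eq_tensor, tensor_mul, pauli₁_mul_self, tensor_one]

theorem isHermitian_pauli (a : PauliIdx n) : (pauli a).IsHermitian := by
  simp only [Matrix.IsHermitian, pauli_eq_tensor, conjTranspose_tensor, conjTranspose_pauli₁]

theorem trace_pauli {a : PauliIdx n} (ha : a ≠ 0) : (pauli a).trace = 0 := by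
  obtain ⟨k, hk⟩ := Function.ne_iff.mp ha
  rw [pauli_eq_tensor, trace_tensor]
  exact Finset.prod_eq_zero (Finset.mem_univ k) (trace_pauli₁ hk)

theorem trace_one_op : (1 : Op n).trace = 2 ^ n := by simp

/-- The sign `±1` by which `P_a` and `P_b` commute. -/
def commSign (a b : PauliIdx n) : ℝ := ∏ k, commSign₁ (a k) (b k)

theorem abs_commSign (a b : PauliIdx n) : |commSign a b| = 1 := by
  simp only [commSign, commSign₁, Finset.abs_prod, abs_pow, abs_neg, abs_one, one_pow,
    Finset.prod_const_one]

theorem pauli_mul_pauli_mul_pauli (a b : PauliIdx n) :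
    pauli a * pauli b * pauli a = (commSign a b : ℂ) • pauli b := by
  simp only [pauli_eq_tensor, tensor_mul, pauli₁_mul_pauli₁_mul_pauli₁, tensor_smul, commSign,
    Complex.ofReal_prod]

theorem sum_pauli_apply_mul_apply (x y z w : Fin n → Fin 2) :
    ∑ b : PauliIdx n, pauli b x y * pauli b z w = if x = w ∧ y = z then 2 ^ n else 0 := by
  simp only [pauli, Matrix.of_apply, ← Finset.prod_mul_distrib]
  rw [← Fintype.prod_sum fun k b => pauli₁ b (x k) (y k) * pauli₁ b (z k) (w k)]
  simp only [sum_pauli₁_apply_mul_apply, Fintype.prod_ite_zero, Finset.prod_const,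
    Finset.card_univ, Fintype.card_fin, funext_iff, forall_and]

theorem sum_pauli_mul_mul_pauli (ρ : Op n) :
    ∑ b, pauli b * ρ * pauli b = (2 ^ n * ρ.trace) • (1 : Op n) := by
  ext x w
  calc (∑ b, pauli b * ρ * pauli b : Op n) x w
      = ∑ z, ∑ y, ρ y z * ∑ b : PauliIdx n, pauli b x y * pauli b z w := by
        simp only [Matrix.sum_apply, Matrix.mul_apply, Finset.sum_mul, Finset.mul_sum]
        rw [Finset.sum_comm]
        refine Finset.sum_congr rfl fun z _ => ?_
        rw [Finset.sum_comm]
        exact Finset.sum_congr rfl fun y _ => Finset.sum_congr rfl fun b _ => by ring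
    _ = ((2 ^ n * ρ.trace) • (1 : Op n)) x w := by
        simp only [sum_pauli_apply_mul_apply, Matrix.trace, Matrix.diag, Matrix.smul_apply,
          Matrix.one_apply]
        by_cases h : x = w
        · simp [h, ← Finset.sum_mul, mul_comm]
        · simp [h]

theorem sum_trace_mul_pauli_smul (E : Op n) :
    ∑ a, (E * pauli a).trace • pauli a = (2 ^ n : ℂ) • E := by
  ext z w
  calc (∑ a, (E * pauli a).trace • pauli a : Op n) z w
      = ∑ x, ∑ y, E x y * ∑ a : PauliIdx n, pauli a y x * pauli a z w := by
        simp only [Matrix.sum_apply, Matrix.smul_apply, smul_eq_mul, Matrix.trace, Matrix.diag,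
          Matrix.mul_apply, Finset.sum_mul, Finset.mul_sum, mul_assoc]
        rw [Finset.sum_comm]
        exact Finset.sum_congr rfl fun x _ => Finset.sum_comm
    _ = ((2 ^ n : ℂ) • E) z w := by
        simp [sum_pauli_apply_mul_apply, ite_and, mul_comm]

theorem sum_trace_mul_pauli_sq (E : Op n) :
    ∑ a, (E * pauli a).trace ^ 2 = 2 ^ n * (E * E).trace := by
  have h := congrArg (fun M => (E * M).trace) (sum_trace_mul_pauli_smul E)
  simpa only [Finset.mul_sum, Matrix.trace_sum, Matrix.mul_smul, Matrix.trace_smul, smul_eq_mul,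
    ← sq] using h

theorem sum_re_trace_mul_pauli_sq_le {E : Op n} (hE : E.PosSemidef) :
    ∑ a, (E * pauli a).trace.re ^ 2 ≤ 2 ^ n * E.trace.re ^ 2 := by
  have hcoe (a : PauliIdx n) :
      (((E * pauli a).trace.re ^ 2 : ℝ) : ℂ) = (E * pauli a).trace ^ 2 := by
    rw [Complex.ofReal_pow, coe_re_trace_mul_of_isHermitian hE.isHermitian (isHermitian_pauli a)]
  rw [← Complex.real_le_real, Complex.ofReal_sum, Complex.ofReal_mul, Complex.ofReal_pow,
    Complex.ofReal_pow, coe_re_trace_of_isHermitian hE.isHermitian]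
  simp only [hcoe, sum_trace_mul_pauli_sq]
  exact mul_le_mul_of_nonneg_left (trace_mul_self_le_of_posSemidef hE) (by positivity)

theorem sum_commSign_smul (a : PauliIdx n) (ρ : Op n) :
    ∑ b, (commSign a b : ℂ) • (pauli b * ρ * pauli b)
      = (2 ^ n * (ρ * pauli a).trace) • pauli a := by
  have hterm (b : PauliIdx n) : (commSign a b : ℂ) • (pauli b * ρ * pauli b)
      = pauli a * (pauli b * (pauli a * ρ) * pauli b) := by
    rw [← Matrix.smul_mul, ← Matrix.smul_mul, ← pauli_mul_pauli_mul_pauli]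
    simp only [mul_assoc]
  simp only [hterm, ← Finset.mul_sum, sum_pauli_mul_mul_pauli, Matrix.mul_smul, mul_one,
    Matrix.trace_mul_comm ρ]

theorem sum_commSign {a : PauliIdx n} (ha : a ≠ 0) : ∑ b, commSign a b = 0 := by
  have h := sum_commSign_smul a 1
  simp only [mul_one, pauli_mul_self, one_mul, trace_pauli ha, mul_zero, zero_smul,
    ← Finset.sum_smul] at h
  exact_mod_cast (smul_eq_zero.mp h).resolve_right one_ne_zero

/-! ### Pauli channels -/

theorem posSemidef_pauliMap {p : PauliIdx n → ℝ} (hp : ∀ a, 0 ≤ p a) {ρ : Op n}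
    (hρ : ρ.PosSemidef) : (pauliMap p ρ).PosSemidef := by
  refine Matrix.posSemidef_sum _ fun a _ => ?_
  have h := hρ.mul_mul_conjTranspose_same (pauli a)
  rw [(isHermitian_pauli a).eq] at h
  exact h.smul (by exact_mod_cast hp a)

theorem trace_pauliMap (p : PauliIdx n → ℝ) (ρ : Op n) :
    (pauliMap p ρ).trace = (∑ a, p a : ℝ) * ρ.trace := by
  have hterm (a : PauliIdx n) : (pauli a * ρ * pauli a).trace = ρ.trace := by
    rw [Matrix.trace_mul_comm, ← mul_assoc, pauli_mul_self, one_mul]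
  simp only [pauliMap, Matrix.trace_sum, Matrix.trace_smul, hterm, smul_eq_mul,
    Complex.ofReal_sum, Finset.sum_mul]

theorem IsPauliChannel.posSemidef {Λ : Op n → Op n} (hΛ : IsPauliChannel Λ) {ρ : Op n}
    (hρ : ρ.PosSemidef) : (Λ ρ).PosSemidef := by
  obtain ⟨p, hp, rfl⟩ := hΛ
  exact posSemidef_pauliMap hp.1 hρ

theorem IsPauliChannel.trace {Λ : Op n → Op n} (hΛ : IsPauliChannel Λ) (ρ : Op n) :
    (Λ ρ).trace = ρ.trace := by
  obtain ⟨p, hp, rfl⟩ := hΛ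
  rw [trace_pauliMap, hp.2, Complex.ofReal_one, one_mul]

/-- The error rates `4⁻ⁿ (1 ± θ)`, the sign being that by which the error commutes with `P_a`. -/
def spikeRates (a : PauliIdx n) (θ : ℝ) (b : PauliIdx n) : ℝ :=
  (4 ^ n)⁻¹ * (1 + θ * commSign a b)

/-- The Pauli channel `ρ ↦ 2⁻ⁿ (Tr[ρ] 1 + θ Tr[P_a ρ] P_a)` (for `a ≠ 0` and `|θ| ≤ 1`), whose
Pauli eigenvalues other than `λ_0 = 1` and `λ_a = θ` vanish. -/
def spikeChannel (a : PauliIdx n) (θ : ℝ) : Op n → Op n := pauliMap (spikeRates a θ)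

/-- The completely depolarizing channel. -/
def depol (n : ℕ) : Op n → Op n := pauliMap fun _ => (4 ^ n)⁻¹

/-- The maximally mixed state. -/
def maxMixed (n : ℕ) : Op n := ((2 : ℝ) ^ n)⁻¹ • 1

/-- The operator `2⁻ⁿ (1 + s P_a)`; a state for `a ≠ 0` and `|s| ≤ 1`. -/
def spikeState (a : PauliIdx n) (s : ℝ) : Op n := maxMixed n + (((2 : ℝ) ^ n)⁻¹ * s) • pauli a

theorem isPauliChannel_depol : IsPauliChannel (depol n) :=
  ⟨_, ⟨fun _ => by positivity, by simp⟩, rfl⟩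

theorem isPauliChannel_spikeChannel {a : PauliIdx n} {θ : ℝ} (ha : a ≠ 0) (hθ : |θ| ≤ 1) :
    IsPauliChannel (spikeChannel a θ) := by
  refine ⟨spikeRates a θ, ⟨fun b => mul_nonneg (by positivity) ?_, ?_⟩, rfl⟩
  · have h : |θ * commSign a b| ≤ 1 := by rwa [abs_mul, abs_commSign, mul_one]
    linarith [(abs_le.mp h).1]
  · simp [spikeRates, ← Finset.mul_sum, Finset.sum_add_distrib, sum_commSign ha]

theorem depol_apply (ρ : Op n) : depol n ρ = ρ.trace • maxMixed n := by
  have h4 : (4 : ℂ) ^ n = 2 ^ n * 2 ^ n := by rw [← mul_pow]; norm_num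
  rw [depol, pauliMap, ← Finset.smul_sum, sum_pauli_mul_mul_pauli, maxMixed, ← Complex.coe_smul,
    smul_smul, smul_smul]
  congr 1
  push_cast
  rw [h4]
  field_simp

theorem spikeChannel_apply (a : PauliIdx n) (θ : ℝ) (ρ : Op n) :
    spikeChannel a θ ρ
      = ρ.trace • maxMixed n + (((2 : ℝ) ^ n)⁻¹ * θ * (ρ * pauli a).trace) • pauli a := by
  have h4 : (4 : ℂ) ^ n = 2 ^ n * 2 ^ n := by rw [← mul_pow]; norm_num
  have hterm (b : PauliIdx n) : (spikeRates a θ b : ℂ) • (pauli b * ρ * pauli b)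
      = (((4 ^ n)⁻¹ : ℝ) : ℂ) • (pauli b * ρ * pauli b)
        + ((4 ^ n)⁻¹ * θ : ℂ) • (commSign a b : ℂ) • (pauli b * ρ * pauli b) := by
    rw [spikeRates]
    push_cast
    module
  rw [← depol_apply, spikeChannel, pauliMap]
  simp only [hterm]
  rw [Finset.sum_add_distrib, ← Finset.smul_sum (r := ((4 ^ n)⁻¹ * θ : ℂ)), sum_commSign_smul,
    smul_smul, depol, pauliMap]
  congr 2
  push_cast
  rw [h4]
  field_simp

theorem pauliEigenvalue_spikeChannel {a : PauliIdx n} (ha : a ≠ 0) (θ : ℝ) :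
    pauliEigenvalue (spikeChannel a θ) a = θ := by
  rw [pauliEigenvalue, spikeChannel_apply, trace_pauli ha, zero_smul, zero_add, pauli_mul_self,
    trace_one_op, Matrix.mul_smul, pauli_mul_self, Matrix.trace_smul, trace_one_op, smul_eq_mul,
    mul_div_cancel_right₀ _ (by positivity)]
  push_cast
  field_simp
  exact Complex.ofReal_re θ

theorem depol_apply_of_isHermitian {ρ : Op n} (hρ : ρ.IsHermitian) :
    depol n ρ = ρ.trace.re • maxMixed n := by
  rw [depol_apply, ← coe_re_trace_of_isHermitian hρ, Complex.coe_smul, Complex.ofReal_re]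

theorem exists_spikeChannel_eq_smul_spikeState (a : PauliIdx n) (θ : ℝ) {ρ : Op n}
    (hρ : ρ.PosSemidef) :
    ∃ s, |s| ≤ |θ| ∧ spikeChannel a θ ρ = ρ.trace.re • spikeState a s := by
  have hle : |(ρ * pauli a).trace.re| ≤ ρ.trace.re :=
    abs_re_trace_mul_le_re_trace hρ (isHermitian_pauli a) (pauli_mul_self a)
  have htr : 0 ≤ ρ.trace.re := (abs_nonneg _).trans hle
  refine ⟨θ * ((ρ * pauli a).trace.re / ρ.trace.re), ?_, ?_⟩
  · rw [abs_mul, abs_div, abs_of_nonneg htr]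
    exact mul_le_of_le_one_right (abs_nonneg θ) (div_le_one_of_le₀ hle htr)
  · have hcoeff : ρ.trace.re * ((ρ * pauli a).trace.re / ρ.trace.re) = (ρ * pauli a).trace.re :=
      mul_div_cancel_of_imp' fun h => abs_nonpos_iff.mp (hle.trans h.le)
    have hΛ := spikeChannel_apply a θ ρ
    rw [← coe_re_trace_of_isHermitian hρ.isHermitian,
      ← coe_re_trace_mul_of_isHermitian hρ.isHermitian (isHermitian_pauli a), Complex.coe_smul,
      ← Complex.ofReal_mul, ← Complex.ofReal_mul, Complex.coe_smul, mul_assoc] at hΛ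
    rw [hΛ, spikeState, smul_add, smul_smul]
    congr 2
    linear_combination (-((2 : ℝ) ^ n)⁻¹ * θ) * hcoeff

/-! ### Measurements -/

section Measurement

variable {A : Type} {E : A → Op n} {ρ : Op n} {a : PauliIdx n} {s θ : ℝ}

/-- The outcome weights `Tr[E o ρ]` of the measurement `E` in the unnormalized state `ρ`. -/
def born (E : A → Op n) (ρ : Op n) (o : A) : ℝ := (E o * ρ).trace.re

theorem born_nonneg (hE : ∀ o, (E o).PosSemidef) (hρ : ρ.PosSemidef) (o : A) : 0 ≤ born E ρ o :=
  (Complex.nonneg_iff.mp (trace_mul_nonneg_of_posSemidef (hE o) hρ)).1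

theorem IsPOVM.sum_born [Fintype A] (hE : IsPOVM E) (ρ : Op n) : ∑ o, born E ρ o = ρ.trace.re := by
  simp only [born]
  rw [← Complex.re_sum, ← Matrix.trace_sum, ← Finset.sum_mul, hE.2, one_mul]

theorem born_smul (c : ℝ) (o : A) : born E (c • ρ) o = c * born E ρ o := by
  rw [born, Matrix.mul_smul, Matrix.trace_smul, Complex.smul_re, smul_eq_mul, born]

theorem born_maxMixed (o : A) : born E (maxMixed n) o = (2 ^ n)⁻¹ * (E o).trace.re := by
  rw [maxMixed, born_smul, born, mul_one]

theorem born_spikeState (o : A) :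
    born E (spikeState a s) o
      = born E (maxMixed n) o + (2 ^ n)⁻¹ * s * (E o * pauli a).trace.re := by
  simp only [born, spikeState, mul_add, Matrix.trace_add, Complex.add_re, Matrix.mul_smul,
    Matrix.trace_smul, Complex.smul_re, smul_eq_mul]

theorem re_trace_maxMixed : (maxMixed n).trace.re = 1 := by
  rw [maxMixed, Matrix.trace_smul, trace_one_op, Complex.smul_re, smul_eq_mul]
  norm_cast
  exact inv_mul_cancel₀ (by positivity)

theorem re_trace_spikeState (ha : a ≠ 0) : (spikeState a s).trace.re = 1 := by
  rw [spikeState, Matrix.trace_add, Matrix.trace_smul, trace_pauli ha, smul_zero, add_zero,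
    re_trace_maxMixed]

theorem one_sub_mul_born_maxMixed_le (hE : ∀ o, (E o).PosSemidef) (hs : |s| ≤ θ) (o : A) :
    (1 - θ) * born E (maxMixed n) o ≤ born E (spikeState a s) o := by
  have hx : |s * (E o * pauli a).trace.re| ≤ θ * (E o).trace.re := by
    rw [abs_mul]
    exact mul_le_mul hs (abs_re_trace_mul_le_re_trace (hE o) (isHermitian_pauli a)
      (pauli_mul_self a)) (abs_nonneg _) ((abs_nonneg s).trans hs)
  have h2 : (0 : ℝ) ≤ (2 ^ n)⁻¹ := by positivity
  rw [born_spikeState, born_maxMixed]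
  linarith [mul_le_mul_of_nonneg_left (neg_le_of_abs_le hx) h2]

theorem born_maxMixed_nonneg (hE : ∀ o, (E o).PosSemidef) (o : A) :
    0 ≤ born E (maxMixed n) o := by
  rw [born_maxMixed]
  exact mul_nonneg (by positivity) (re_trace_nonneg_of_posSemidef (hE o))

theorem born_maxMixed_eq_zero (hE : ∀ o, (E o).PosSemidef) (hs : |s| ≤ θ) (hθ : θ < 1) {o : A}
    (ho : born E (spikeState a s) o = 0) : born E (maxMixed n) o = 0 :=
  le_antisymm
    (nonpos_of_mul_nonpos_right ((one_sub_mul_born_maxMixed_le hE hs o).trans ho.le)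
      (sub_pos.mpr hθ))
    (born_maxMixed_nonneg hE o)

/-- The second-order information that the measurement `E` provides on the Pauli coefficient along
`P_a` of a state close to the maximally mixed one. -/
def povmInfo [Fintype A] (E : A → Op n) (a : PauliIdx n) : ℝ :=
  ∑ o, (2 ^ n)⁻¹ * ((E o * pauli a).trace.re ^ 2 / (E o).trace.re)

theorem sq_born_sub_born_div_le (hE : ∀ o, (E o).PosSemidef) (hs : |s| ≤ θ) (hθ : θ < 1) (o : A) :
    (born E (maxMixed n) o - born E (spikeState a s) o) ^ 2 / born E (spikeState a s) o
      ≤ θ ^ 2 / (1 - θ) * ((2 ^ n)⁻¹ * ((E o * pauli a).trace.re ^ 2 / (E o).trace.re)) := by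
  have hθ' : 0 < 1 - θ := sub_pos.mpr hθ
  have hx := abs_re_trace_mul_le_re_trace (hE o) (isHermitian_pauli a) (pauli_mul_self a)
  have hle := one_sub_mul_born_maxMixed_le (a := a) hE hs o
  have hs2 : s ^ 2 ≤ θ ^ 2 := sq_le_sq' (neg_le_of_abs_le hs) (le_of_abs_le hs)
  have hsub : (born E (maxMixed n) o - born E (spikeState a s) o) ^ 2
      = s ^ 2 * ((2 ^ n)⁻¹ * (E o * pauli a).trace.re) ^ 2 := by
    rw [born_spikeState]
    ring
  rw [hsub]
  set x := (E o * pauli a).trace.re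
  rcases (re_trace_nonneg_of_posSemidef (hE o)).eq_or_lt' with htr | htr
  · have hx0 : x = 0 := abs_nonpos_iff.mp (hx.trans htr.le)
    simp [hx0]
  · rw [born_maxMixed] at hle
    calc s ^ 2 * ((2 ^ n)⁻¹ * x) ^ 2 / born E (spikeState a s) o
        ≤ θ ^ 2 * ((2 ^ n)⁻¹ * x) ^ 2 / ((1 - θ) * ((2 ^ n)⁻¹ * (E o).trace.re)) := by gcongr
      _ = θ ^ 2 / (1 - θ) * ((2 ^ n)⁻¹ * (x ^ 2 / (E o).trace.re)) := by field_simp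

theorem IsPOVM.relEntropy_born_spikeState_le [Fintype A] (hE : IsPOVM E) (ha : a ≠ 0)
    (hs : |s| ≤ θ) (hθ : θ < 1) :
    relEntropy (born E (maxMixed n)) (born E (spikeState a s))
      ≤ θ ^ 2 / (1 - θ) * povmInfo E a := by
  have hp := born_maxMixed_nonneg hE.1
  have hq (o : A) : 0 ≤ born E (spikeState a s) o :=
    (mul_nonneg (sub_pos.mpr hθ).le (hp o)).trans (one_sub_mul_born_maxMixed_le hE.1 hs o)
  have hsum : ∑ o, born E (maxMixed n) o = ∑ o, born E (spikeState a s) o := by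
    rw [hE.sum_born, hE.sum_born, re_trace_maxMixed, re_trace_spikeState ha]
  calc relEntropy (born E (maxMixed n)) (born E (spikeState a s))
      ≤ ∑ o, (born E (maxMixed n) o - born E (spikeState a s) o) ^ 2 / born E (spikeState a s) o :=
        relEntropy_le_chiSq hp hq (fun o => born_maxMixed_eq_zero hE.1 hs hθ) hsum.le
    _ ≤ θ ^ 2 / (1 - θ) * povmInfo E a := by
        rw [povmInfo, Finset.mul_sum]
        exact Finset.sum_le_sum fun o _ => sq_born_sub_born_div_le hE.1 hs hθ o

theorem sum_sq_re_trace_mul_pauli_div_le {F : Op n} (hF : F.PosSemidef) :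
    ∑ a, (2 ^ n)⁻¹ * ((F * pauli a).trace.re ^ 2 / F.trace.re) ≤ F.trace.re := by
  have htr := re_trace_nonneg_of_posSemidef hF
  rw [← Finset.mul_sum, ← Finset.sum_div, inv_mul_le_iff₀ (by positivity)]
  refine div_le_of_le_mul₀ htr (by positivity) ?_
  rw [mul_assoc, ← sq]
  exact sum_re_trace_mul_pauli_sq_le hF

theorem povmInfo_nonneg [Fintype A] (hE : ∀ o, (E o).PosSemidef) (a : PauliIdx n) :
    0 ≤ povmInfo E a :=
  Finset.sum_nonneg fun o _ => mul_nonneg (by positivity)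
    (div_nonneg (sq_nonneg _) (re_trace_nonneg_of_posSemidef (hE o)))

theorem IsPOVM.sum_povmInfo_le [Fintype A] (hE : IsPOVM E) : ∑ a, povmInfo E a ≤ 2 ^ n := by
  calc ∑ a, povmInfo E a ≤ ∑ o, (E o).trace.re := by
        simp only [povmInfo]
        rw [Finset.sum_comm]
        exact Finset.sum_le_sum fun o _ => sum_sq_re_trace_mul_pauli_div_le (hE.1 o)
    _ = 2 ^ n := by
        rw [← Complex.re_sum, ← Matrix.trace_sum, hE.2, trace_one_op]
        exact_mod_cast Complex.ofReal_re (2 ^ n)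

theorem IsTrivialPOVM.povmInfo_eq_zero [Fintype A] (hE : IsTrivialPOVM E) (ha : a ≠ 0) :
    povmInfo E a = 0 := by
  refine Finset.sum_eq_zero fun o _ => ?_
  obtain ⟨c, hc⟩ := hE o
  simp [hc, trace_pauli ha]

open Classical in
theorem IsPOVM.sum_compl_povmInfo_le [Fintype A] (hE : IsPOVM E) :
    ∑ a ∈ {0}ᶜ, povmInfo E a ≤ 2 ^ n * (if IsTrivialPOVM E then 0 else 1 : ℕ) := by
  split_ifs with htriv
  · rw [Nat.cast_zero, mul_zero]
    exact (Finset.sum_eq_zero fun a ha => htriv.povmInfo_eq_zero (by simpa using ha)).le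
  · rw [Nat.cast_one, mul_one]
    exact (Finset.sum_le_univ_sum_of_nonneg (povmInfo_nonneg hE.1)).trans hE.sum_povmInfo_le

end Measurement

/-! ### Effects of completely positive maps -/

section Effect

variable {A : Type}

/-- The effect `C†(1)` of a completely positive map `C`, determined by
`Tr[C†(1) ρ] = Tr[C(ρ)]`. -/
def effect (C : Op n →CP Op n) : Op n :=
  Matrix.of fun i j => (C (Matrix.single j i 1)).trace

theorem trace_effect_mul (C : Op n →CP Op n) (ρ : Op n) :
    (effect C * ρ).trace = (C ρ).trace := by
  have hsingle (i j : Fin n → Fin 2) :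
      Matrix.single i j (ρ i j) = ρ i j • (Matrix.single i j 1 : Op n) := by
    rw [Matrix.smul_single, smul_eq_mul, mul_one]
  conv_rhs => rw [Matrix.matrix_eq_sum_single ρ]
  simp only [hsingle, map_sum, map_smul, Matrix.trace_sum, Matrix.trace_smul, smul_eq_mul]
  rw [Finset.sum_comm]
  simp only [Matrix.trace, Matrix.diag, Matrix.mul_apply, effect, Matrix.of_apply, mul_comm]

theorem posSemidef_map_of_posSemidef (C : Op n →CP Op n) {ρ : Op n} (hρ : ρ.PosSemidef) :
    (C ρ).PosSemidef := by
  have h : C 0 ≤ C ρ := OrderHomClass.mono C hρ.nonneg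
  rw [map_zero] at h
  exact Matrix.nonneg_iff_posSemidef.mp h

theorem isHermitian_effect (C : Op n →CP Op n) : (effect C).IsHermitian := by
  ext i j
  simp only [Matrix.conjTranspose_apply, effect, Matrix.of_apply]
  rw [← Matrix.trace_conjTranspose, ← Matrix.star_eq_conjTranspose, ← map_star,
    Matrix.star_eq_conjTranspose, Matrix.conjTranspose_single, star_one]

theorem posSemidef_effect (C : Op n →CP Op n) : (effect C).PosSemidef := by
  refine .of_dotProduct_mulVec_nonneg (isHermitian_effect C) fun v => ?_
  have h := (posSemidef_map_of_posSemidef C (Matrix.posSemidef_vecMulVec_self_star v)).trace_nonneg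
  rwa [← trace_effect_mul, Matrix.mul_vecMulVec, Matrix.trace_vecMulVec, dotProduct_comm] at h

theorem IsInstrument.isPOVM_effect [Fintype A] {C : A → (Op n →CP Op n)} (hC : IsInstrument C) :
    IsPOVM fun o => effect (C o) := by
  refine ⟨fun o => posSemidef_effect _, Matrix.ext_iff_trace_mul_right.mpr fun ρ => ?_⟩
  simp only [Finset.sum_mul, Matrix.trace_sum, one_mul, trace_effect_mul]
  exact hC ρ

theorem IsTrivialInstrument.isTrivialPOVM_effect {C : A → (Op n →CP Op n)}
    (hC : IsTrivialInstrument C) : IsTrivialPOVM fun o => effect (C o) := by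
  intro o
  obtain ⟨c, Φ, hΦ, h⟩ := hC o
  refine ⟨c, Matrix.ext_iff_trace_mul_right.mpr fun ρ => ?_⟩
  rw [trace_effect_mul, h, Matrix.trace_smul, hΦ, Matrix.smul_mul, one_mul, Matrix.trace_smul]

open Classical in
theorem IsInstrument.sum_compl_povmInfo_effect_le [Fintype A] {C : A → (Op n →CP Op n)}
    (hC : IsInstrument C) :
    ∑ a ∈ {0}ᶜ, povmInfo (fun o => effect (C o)) a
      ≤ 2 ^ n * (if ¬ IsTrivialInstrument C then 1 else 0 : ℕ) := by
  rw [ite_not]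
  refine hC.isPOVM_effect.sum_compl_povmInfo_le.trans ?_
  gcongr
  by_cases h : IsTrivialInstrument C
  · rw [if_pos h, if_pos h.isTrivialPOVM_effect]
  · rw [if_neg h]
    split_ifs <;> norm_num

end Effect

/-! ### One round of an adaptive experiment -/

section Round

variable {H A : Type} {E : H → A → Op n} {a : PauliIdx n} {θ : ℝ} {ρ ρ₀ : H → Op n}

theorem born_depol (E : A → Op n) {ρ : Op n} (hρ : ρ.IsHermitian) (o : A) :
    born E (depol n ρ) o = ρ.trace.re * born E (maxMixed n) o := by
  rw [depol_apply_of_isHermitian hρ, born_smul]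

variable [Fintype A]

theorem sum_born_depol_mul [Fintype H] (hE : ∀ h, IsPOVM (E h)) (ρ : H → Op n) (J : H → ℝ) :
    ∑ x : H × A, born (E x.1) (depol n (ρ x.1)) x.2 * J x.1 = ∑ h, (ρ h).trace.re * J h := by
  simp only [Fintype.sum_prod_type, ← Finset.sum_mul, (hE _).sum_born, isPauliChannel_depol.trace]

theorem born_depol_eq_zero {E : A → Op n} (hE : IsPOVM E) (hθ : |θ| < 1) {ρ ρ₀ : Op n}
    (hρ₀ : ρ₀.PosSemidef) (hρ : ρ.PosSemidef) (hac : ρ.trace.re = 0 → ρ₀.trace.re = 0) {o : A}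
    (ho : born E (spikeChannel a θ ρ) o = 0) : born E (depol n ρ₀) o = 0 := by
  obtain ⟨s, hs, hΛ⟩ := exists_spikeChannel_eq_smul_spikeState a θ hρ
  rw [hΛ, born_smul, mul_eq_zero] at ho
  rw [born_depol E hρ₀.isHermitian, mul_eq_zero]
  exact ho.imp hac (born_maxMixed_eq_zero hE.1 hs hθ)

theorem relEntropy_born_le [Fintype H] (hE : ∀ h, IsPOVM (E h)) (ha : a ≠ 0) (hθ : |θ| < 1)
    (hρ₀ : ∀ h, (ρ₀ h).PosSemidef) (hρ : ∀ h, (ρ h).PosSemidef)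
    (hac : ∀ h, (ρ h).trace.re = 0 → (ρ₀ h).trace.re = 0) :
    relEntropy (fun x : H × A => born (E x.1) (depol n (ρ₀ x.1)) x.2)
        (fun x => born (E x.1) (spikeChannel a θ (ρ x.1)) x.2)
      ≤ relEntropy (fun h => (ρ₀ h).trace.re) (fun h => (ρ h).trace.re)
        + θ ^ 2 / (1 - |θ|) * ∑ h, (ρ₀ h).trace.re * povmInfo (E h) a := by
  choose s hs hΛ using fun h => exists_spikeChannel_eq_smul_spikeState a θ (hρ h)
  simp only [hΛ, born_smul, born_depol _ (hρ₀ _).isHermitian]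
  rw [relEntropy_prod (u := fun h => (ρ₀ h).trace.re) (v := fun h => (ρ h).trace.re)
    (P := fun h => born (E h) (maxMixed n)) (Q := fun h => born (E h) (spikeState a (s h))) hac
    (fun h o => born_maxMixed_eq_zero (hE h).1 (hs h) hθ)
    fun h => by rw [(hE h).sum_born, re_trace_maxMixed], Finset.mul_sum]
  refine add_le_add_right (Finset.sum_le_sum fun h _ => ?_) _
  rw [mul_left_comm, ← sq_abs θ]
  exact mul_le_mul_of_nonneg_left ((hE h).relEntropy_born_spikeState_le ha (hs h) hθ)
    (re_trace_nonneg_of_posSemidef (hρ₀ h))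

theorem relEntropy_born_le_sum_mul_add_povmInfo [Fintype H] (hE : ∀ h, IsPOVM (E h)) (ha : a ≠ 0)
    (hθ : |θ| < 1) (hρ₀ : ∀ h, (ρ₀ h).PosSemidef) (hρ : ∀ h, (ρ h).PosSemidef)
    (hac : ∀ h, (ρ h).trace.re = 0 → (ρ₀ h).trace.re = 0) {J : H → ℝ}
    (hJ : relEntropy (fun h => (ρ₀ h).trace.re) (fun h => (ρ h).trace.re)
      ≤ θ ^ 2 / (1 - |θ|) * ∑ h, (ρ₀ h).trace.re * J h) :
    relEntropy (fun x : H × A => born (E x.1) (depol n (ρ₀ x.1)) x.2)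
        (fun x => born (E x.1) (spikeChannel a θ (ρ x.1)) x.2)
      ≤ θ ^ 2 / (1 - |θ|) *
        ∑ x : H × A, born (E x.1) (depol n (ρ₀ x.1)) x.2 * (J x.1 + povmInfo (E x.1) a) := by
  rw [sum_born_depol_mul hE ρ₀ fun h => J h + povmInfo (E h) a]
  simp only [mul_add, Finset.sum_add_distrib] at hJ ⊢
  exact (relEntropy_born_le hE ha hθ hρ₀ hρ hac).trans (add_le_add_left hJ _)

end Round

/-! ### Histories -/

section Hist

variable {A : ℕ → Type} {t : ℕ}

/-- The history without its last register. -/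
abbrev Hist.init (h : Hist A (t + 1)) : Hist A t := fun k => h k.castSucc

/-- A history, split into the history without its last register and the content of that register. -/
def Hist.initLast : Hist A (t + 1) ≃ Hist A t × A t :=
  (Fin.snocEquiv fun k : Fin (t + 1) => A k).symm.trans (Equiv.prodComm _ _)

theorem Hist.sum_initLast [∀ t, Fintype (A t)] (f : Hist A t × A t → ℝ) :
    ∑ h : Hist A (t + 1), f (h.init, h (Fin.last t)) = ∑ x, f x :=
  Hist.initLast.sum_comp f

theorem relEntropy_initLast [∀ t, Fintype (A t)] (p q : Hist A t × A t → ℝ) :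
    relEntropy (fun h : Hist A (t + 1) => p (h.init, h (Fin.last t)))
        (fun h => q (h.init, h (Fin.last t))) = relEntropy p q :=
  relEntropy_comp_equiv Hist.initLast p q

end Hist

namespace Scheme

variable {m : ℕ} (S : Scheme n m) {Λ : Op n → Op n} {a : PauliIdx n} {θ : ℝ}

/-! ### Outcome statistics of a scheme -/

/-- The effects of the instrument applied after the `(t + 1)`-st copy of the channel. -/
def effects (t : ℕ) (h : Hist S.A (t + 1)) : S.A (t + 1) → Op n := fun o => effect (S.instr t h o)

theorem isPOVM_effects {t : ℕ} (ht : t < m) (h : Hist S.A (t + 1)) : IsPOVM (S.effects t h) :=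
  (S.instr_isInstrument t ht h).isPOVM_effect

theorem posSemidef_state (hΛ : IsPauliChannel Λ) (t : ℕ) (h : Hist S.A (t + 1)) :
    (S.state Λ t h).PosSemidef := by
  induction t with
  | zero => exact S.init_posSemidef _
  | succ t ih => exact posSemidef_map_of_posSemidef _ (hΛ.posSemidef (ih h.init))

theorem re_trace_state_succ (Λ : Op n → Op n) (t : ℕ) (h : Hist S.A (t + 2)) :
    (S.state Λ (t + 1) h).trace.re
      = born (S.effects t h.init) (Λ (S.state Λ t h.init)) (h (Fin.last (t + 1))) :=
  congrArg Complex.re (trace_effect_mul _ _).symm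

theorem prob_eq_born (Λ : Op n → Op n) (o : S.Outcome) :
    S.prob Λ o = born (S.povm o.init) (Λ (S.state Λ m o.init)) (o (Fin.last (m + 1))) :=
  rfl

theorem sum_re_trace_state (hΛ : IsPauliChannel Λ) {t : ℕ} (ht : t ≤ m) :
    ∑ h, (S.state Λ t h).trace.re = 1 := by
  induction t with
  | zero =>
    rw [← Complex.one_re, ← S.init_trace, Complex.re_sum]
    exact (Equiv.piUnique fun k : Fin 1 => S.A k).sum_comp fun o => (S.init o).trace.re
  | succ t ih =>
    simp only [re_trace_state_succ]
    rw [Hist.sum_initLast fun x => born (S.effects t x.1) (Λ (S.state Λ t x.1)) x.2,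
      Fintype.sum_prod_type]
    simp only [(S.isPOVM_effects ht _).sum_born, hΛ.trace]
    exact ih (Nat.le_of_succ_le ht)

theorem prob_nonneg (hΛ : IsPauliChannel Λ) (o : S.Outcome) : 0 ≤ S.prob Λ o :=
  born_nonneg (S.povm_isPOVM _).1 (hΛ.posSemidef (S.posSemidef_state hΛ m _)) _

theorem sum_prob (hΛ : IsPauliChannel Λ) : ∑ o, S.prob Λ o = 1 := by
  simp only [prob_eq_born]
  rw [Hist.sum_initLast fun x => born (S.povm x.1) (Λ (S.state Λ m x.1)) x.2,
    Fintype.sum_prod_type]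
  simp only [(S.povm_isPOVM _).sum_born, hΛ.trace]
  exact S.sum_re_trace_state hΛ le_rfl

theorem prob_mem_stdSimplex (hΛ : IsPauliChannel Λ) : S.prob Λ ∈ stdSimplex ℝ S.Outcome :=
  ⟨S.prob_nonneg hΛ, S.sum_prob hΛ⟩

theorem re_trace_state_depol_eq_zero (ha : a ≠ 0) (hθ : |θ| < 1) {t : ℕ} (ht : t ≤ m)
    (h : Hist S.A (t + 1)) (h₀ : (S.state (spikeChannel a θ) t h).trace.re = 0) :
    (S.state (depol n) t h).trace.re = 0 := by
  induction t with
  | zero => exact h₀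
  | succ t ih =>
    rw [re_trace_state_succ] at h₀ ⊢
    exact born_depol_eq_zero (S.isPOVM_effects ht _) hθ
      (S.posSemidef_state isPauliChannel_depol t _)
      (S.posSemidef_state (isPauliChannel_spikeChannel ha hθ.le) t _)
      (ih (Nat.le_of_succ_le ht) h.init) h₀

theorem prob_depol_eq_zero (ha : a ≠ 0) (hθ : |θ| < 1) (o : S.Outcome)
    (h₀ : S.prob (spikeChannel a θ) o = 0) : S.prob (depol n) o = 0 :=
  born_depol_eq_zero (S.povm_isPOVM _) hθ (S.posSemidef_state isPauliChannel_depol m _)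
    (S.posSemidef_state (isPauliChannel_spikeChannel ha hθ.le) m _)
    (S.re_trace_state_depol_eq_zero ha hθ le_rfl o.init) h₀

/-! ### Information gathered by a scheme -/

/-- The information on the Pauli coefficient along `P_a` gathered by the first `t` instruments. -/
def instrInfo (a : PauliIdx n) (t : ℕ) (h : Hist S.A (t + 1)) : ℝ :=
  ∑ s : Fin t, povmInfo (S.effects s fun k => h (k.castLE (Nat.succ_le_succ s.isLt.le))) a

/-- The information on the Pauli coefficient along `P_a` gathered along the outcome sequence `o`. -/
def info (a : PauliIdx n) (o : S.Outcome) : ℝ :=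
  S.instrInfo a m o.init + povmInfo (S.povm o.init) a

theorem instrInfo_succ (a : PauliIdx n) (t : ℕ) (h : Hist S.A (t + 2)) :
    S.instrInfo a (t + 1) h = S.instrInfo a t h.init + povmInfo (S.effects t h.init) a :=
  Fin.sum_univ_castSucc _

theorem relEntropy_state_le (ha : a ≠ 0) (hθ : |θ| < 1) {t : ℕ} (ht : t ≤ m) :
    relEntropy (fun h => (S.state (depol n) t h).trace.re)
        (fun h => (S.state (spikeChannel a θ) t h).trace.re)
      ≤ θ ^ 2 / (1 - |θ|) * ∑ h, (S.state (depol n) t h).trace.re * S.instrInfo a t h := by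
  induction t with
  | zero =>
    simp only [instrInfo, Finset.univ_eq_empty, Finset.sum_empty, mul_zero, Finset.sum_const_zero]
    exact (relEntropy_self _).le
  | succ t ih =>
    simp only [re_trace_state_succ, instrInfo_succ]
    rw [relEntropy_initLast
        (fun x => born (S.effects t x.1) (depol n (S.state (depol n) t x.1)) x.2)
        (fun x => born (S.effects t x.1) (spikeChannel a θ (S.state (spikeChannel a θ) t x.1)) x.2),
      Hist.sum_initLast fun x => born (S.effects t x.1) (depol n (S.state (depol n) t x.1)) x.2 *
        (S.instrInfo a t x.1 + povmInfo (S.effects t x.1) a)]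
    exact relEntropy_born_le_sum_mul_add_povmInfo (S.isPOVM_effects ht) ha hθ
      (S.posSemidef_state isPauliChannel_depol t)
      (S.posSemidef_state (isPauliChannel_spikeChannel ha hθ.le) t)
      (S.re_trace_state_depol_eq_zero ha hθ (Nat.le_of_succ_le ht)) (ih (Nat.le_of_succ_le ht))

theorem relEntropy_prob_le (ha : a ≠ 0) (hθ : |θ| < 1) :
    relEntropy (S.prob (depol n)) (S.prob (spikeChannel a θ))
      ≤ θ ^ 2 / (1 - |θ|) * ∑ o, S.prob (depol n) o * S.info a o := by
  have h := relEntropy_born_le_sum_mul_add_povmInfo S.povm_isPOVM ha hθ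
    (S.posSemidef_state isPauliChannel_depol m)
    (S.posSemidef_state (isPauliChannel_spikeChannel ha hθ.le) m)
    (S.re_trace_state_depol_eq_zero ha hθ le_rfl) (S.relEntropy_state_le ha hθ le_rfl)
  rwa [← relEntropy_initLast, ← Hist.sum_initLast] at h

open Classical in
theorem sum_compl_info_le (o : S.Outcome) : ∑ a ∈ {0}ᶜ, S.info a o ≤ 2 ^ n * S.measCount o := by
  simp only [info, instrInfo, measCount, Finset.sum_add_distrib]
  rw [Nat.cast_add, mul_add, Finset.sum_comm, Finset.card_filter, Nat.cast_sum, Finset.mul_sum]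
  exact add_le_add (Finset.sum_le_sum fun t _ =>
    (S.instr_isInstrument t t.isLt _).sum_compl_povmInfo_effect_le)
    (S.povm_isPOVM _).sum_compl_povmInfo_le

theorem measCount_le_numMeas (hΛ : IsPauliChannel Λ) {o : S.Outcome} (ho : 0 < S.prob Λ o) :
    S.measCount o ≤ S.numMeas := by
  classical
  exact Finset.le_sup (f := S.measCount) (Finset.mem_filter.mpr ⟨Finset.mem_univ o, Λ, hΛ, ho⟩)

theorem numMeas_le_numCopies : S.numMeas ≤ S.numCopies := by
  classical
  refine Finset.sup_le fun o _ => Nat.add_le_add ?_ (by split_ifs <;> simp)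
  exact (Finset.card_filter_le _ _).trans (Finset.card_fin m).le

theorem sum_prob_mul_measCount_le (hΛ : IsPauliChannel Λ) :
    ∑ o, S.prob Λ o * S.measCount o ≤ S.numMeas := by
  calc ∑ o, S.prob Λ o * S.measCount o ≤ ∑ o, S.prob Λ o * S.numMeas := by
        refine Finset.sum_le_sum fun o _ => ?_
        rcases (S.prob_nonneg hΛ o).eq_or_lt with h | h
        · rw [← h, zero_mul, zero_mul]
        · exact mul_le_mul_of_nonneg_left (Nat.cast_le.mpr (S.measCount_le_numMeas hΛ h)) h.le
    _ = S.numMeas := by rw [← Finset.sum_mul, S.sum_prob hΛ, one_mul]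

theorem sum_compl_relEntropy_prob_le (hθ : |θ| < 1) :
    ∑ a ∈ {0}ᶜ, relEntropy (S.prob (depol n)) (S.prob (spikeChannel a θ))
      ≤ θ ^ 2 / (1 - |θ|) * (2 ^ n * S.numMeas) := by
  have hc : 0 ≤ θ ^ 2 / (1 - |θ|) := div_nonneg (sq_nonneg θ) (sub_pos.mpr hθ).le
  have hp := S.prob_nonneg isPauliChannel_depol
  calc ∑ a ∈ {0}ᶜ, relEntropy (S.prob (depol n)) (S.prob (spikeChannel a θ))
      ≤ ∑ a ∈ {0}ᶜ, θ ^ 2 / (1 - |θ|) * ∑ o, S.prob (depol n) o * S.info a o :=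
        Finset.sum_le_sum fun a ha => S.relEntropy_prob_le (by simpa using ha) hθ
    _ = θ ^ 2 / (1 - |θ|) * ∑ o, S.prob (depol n) o * ∑ a ∈ {0}ᶜ, S.info a o := by
        rw [← Finset.mul_sum, Finset.sum_comm]
        simp only [Finset.mul_sum]
    _ ≤ θ ^ 2 / (1 - |θ|) * ∑ o, S.prob (depol n) o * (2 ^ n * S.measCount o) :=
        mul_le_mul_of_nonneg_left (Finset.sum_le_sum fun o _ =>
          mul_le_mul_of_nonneg_left (S.sum_compl_info_le o) (hp o)) hc
    _ = θ ^ 2 / (1 - |θ|) * (2 ^ n * ∑ o, S.prob (depol n) o * S.measCount o) := by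
        simp only [Finset.mul_sum, mul_left_comm]
    _ ≤ θ ^ 2 / (1 - |θ|) * (2 ^ n * S.numMeas) := by
        gcongr
        exact S.sum_prob_mul_measCount_le isPauliChannel_depol

end Scheme

/-! ### The lower bound -/

theorem card_compl_zero_pauliIdx : (({0}ᶜ : Finset (PauliIdx n)).card : ℝ) = 4 ^ n - 1 := by
  have hcard : Fintype.card (PauliIdx n) = 4 ^ n := by simp
  rw [Finset.card_compl, hcard, Finset.card_singleton,
    Nat.cast_sub (Nat.one_le_pow _ _ (by norm_num))]
  norm_num

theorem three_quarters_mul_two_pow_div_le (hn : 1 ≤ n) (ε : ℝ) :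
    3 / 4 * (2 ^ n / ε ^ 2) ≤ ((4 : ℝ) ^ n - 1) / (2 ^ n * ε ^ 2) := by
  have h4 : (4 : ℝ) ≤ 4 ^ n := le_self_pow₀ (by norm_num) (Nat.one_le_iff_ne_zero.mp hn)
  have h2 : (2 : ℝ) ^ n * 2 ^ n = 4 ^ n := by rw [← mul_pow]; norm_num
  rw [← div_div, ← mul_div_assoc]
  gcongr
  rw [le_div_iff₀ (by positivity), mul_assoc, h2]
  linarith

namespace Scheme

variable {m : ℕ} {S : Scheme n m} {est : S.Outcome → PauliIdx n → ℝ} {a : PauliIdx n} {ε θ : ℝ}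

theorem Learns.relEntropy_add_relEntropy_ge (hS : S.Learns est ε) (ha : a ≠ 0) (hε : 0 ≤ ε)
    (hθε : ε < θ) (hθ : θ < 1) :
    1 / 9 ≤ relEntropy (S.prob (depol n)) (S.prob (spikeChannel a θ))
      + relEntropy (S.prob (depol n)) (S.prob (spikeChannel a (-θ))) := by
  classical
  have hp : |θ| < 1 := by rwa [abs_of_nonneg (hε.trans hθε.le)]
  have hm : |-θ| < 1 := by rwa [abs_neg]
  have hΛp := isPauliChannel_spikeChannel ha hp.le
  have hΛm := isPauliChannel_spikeChannel ha hm.le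
  set G : Finset S.Outcome := Finset.univ.filter fun o => 0 ≤ est o a with hG
  have hGp : 2 / 3 ≤ ∑ o ∈ G, S.prob (spikeChannel a θ) o := by
    refine (hS _ hΛp a).trans (Finset.sum_le_sum_of_subset_of_nonneg (fun o ho => ?_)
      fun o _ _ => S.prob_nonneg hΛp o)
    rw [Finset.mem_filter, pauliEigenvalue_spikeChannel ha] at ho
    exact Finset.mem_filter.mpr ⟨ho.1, by linarith [(abs_le.mp ho.2).1]⟩
  have hGm : 2 / 3 ≤ ∑ o ∈ Gᶜ, S.prob (spikeChannel a (-θ)) o := by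
    refine (hS _ hΛm a).trans (Finset.sum_le_sum_of_subset_of_nonneg (fun o ho => ?_)
      fun o _ _ => S.prob_nonneg hΛm o)
    rw [Finset.mem_filter, pauliEigenvalue_spikeChannel ha] at ho
    rw [Finset.mem_compl, hG, Finset.mem_filter, not_and, not_le]
    exact fun _ => by linarith [(abs_le.mp ho.2).2]
  have hsum := Finset.sum_add_sum_compl G (S.prob (spikeChannel a (-θ)))
  rw [S.sum_prob hΛm] at hsum
  calc (1 / 9 : ℝ) = (1 / 3) ^ 2 := by norm_num
    _ ≤ relEntropy (S.prob (depol n)) (S.prob (spikeChannel a θ))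
        + relEntropy (S.prob (depol n)) (S.prob (spikeChannel a (-θ))) :=
      sq_le_relEntropy_add_relEntropy (S.prob_mem_stdSimplex isPauliChannel_depol)
        (S.prob_mem_stdSimplex hΛp) (S.prob_mem_stdSimplex hΛm) (S.prob_depol_eq_zero ha hp)
        (S.prob_depol_eq_zero ha hm) G (by norm_num) (by norm_num) (by linarith)

theorem Learns.one_sub_mul_le_mul_numMeas (hS : S.Learns est ε) (hε : 0 ≤ ε) (hθε : ε < θ)
    (hθ : θ < 1) :
    (1 - θ) * (4 ^ n - 1) ≤ 18 * (θ ^ 2 * (2 ^ n * S.numMeas)) := by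
  have hθ₀ : |θ| = θ := abs_of_nonneg (hε.trans hθε.le)
  have hlow := Finset.card_nsmul_le_sum ({0}ᶜ : Finset (PauliIdx n)) _ _ fun a ha =>
    hS.relEntropy_add_relEntropy_ge (by simpa using ha) hε hθε hθ
  have hp := S.sum_compl_relEntropy_prob_le (hθ₀.trans_lt hθ)
  have hm := S.sum_compl_relEntropy_prob_le (θ := -θ) (by rwa [abs_neg, hθ₀])
  rw [nsmul_eq_mul, card_compl_zero_pauliIdx, Finset.sum_add_distrib] at hlow
  rw [neg_sq, abs_neg, hθ₀] at hm
  rw [hθ₀] at hp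
  have h : (4 ^ n - 1 : ℝ) ≤ 18 * (θ ^ 2 * (2 ^ n * S.numMeas)) / (1 - θ) := by
    linear_combination 9 * (hlow + hp + hm)
  rwa [le_div_iff₀' (sub_pos.mpr hθ)] at h

theorem Learns.numMeas_ge (hS : S.Learns est ε) (hε : 0 < ε) (hε₁ : ε < 1) :
    (1 - ε) / 18 * ((4 ^ n - 1) / (2 ^ n * ε ^ 2)) ≤ S.numMeas := by
  -- The estimator separates the eigenvalues `±θ` only for `θ > ε`; let `θ` decrease to `ε`.
  have hlim : (1 - ε) * (4 ^ n - 1) ≤ 18 * (ε ^ 2 * (2 ^ n * S.numMeas)) := by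
    refine ContinuousWithinAt.closure_le (s := Set.Ioo ε 1)
      (f := fun θ => (1 - θ) * ((4 : ℝ) ^ n - 1))
      (g := fun θ => 18 * (θ ^ 2 * (2 ^ n * (S.numMeas : ℝ)))) ?_
      (by fun_prop) (by fun_prop)
      fun θ hθ => hS.one_sub_mul_le_mul_numMeas hε.le hθ.1 hθ.2
    rw [closure_Ioo hε₁.ne]
    exact Set.left_mem_Icc.mpr hε₁.le
  rw [div_mul_div_comm, div_le_iff₀ (by positivity)]
  linear_combination hlim

theorem Learns.mul_le_numMeas {ε₀ κ : ℝ} (hS : S.Learns est ε) (hε : 0 < ε) (hε' : ε ≤ ε₀)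
    (hε₀ : ε₀ < 1) (hκ : κ ≤ (1 - ε₀) / 18) :
    κ * ((4 ^ n - 1) / (2 ^ n * ε ^ 2)) ≤ S.numMeas := by
  have h4 : (1 : ℝ) ≤ 4 ^ n := one_le_pow₀ (by norm_num)
  refine le_trans ?_ (hS.numMeas_ge hε (hε'.trans_lt hε₀))
  exact mul_le_mul_of_nonneg_right (by linarith)
    (div_nonneg (sub_nonneg.mpr h4) (by positivity))

theorem Learns.mul_two_pow_div_le_numMeas {ε₀ : ℝ} (hS : S.Learns est ε) (hn : 1 ≤ n) (hε : 0 < ε)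
    (hε' : ε ≤ ε₀) (hε₀ : ε₀ < 1) :
    3 / 4 * ((1 - ε₀) / 18) * (2 ^ n / ε ^ 2) ≤ S.numMeas := by
  refine le_trans ?_ (hS.mul_le_numMeas hε hε' hε₀ le_rfl)
  rw [mul_right_comm, mul_comm]
  exact mul_le_mul_of_nonneg_left (three_quarters_mul_two_pow_div_le hn ε) (by linarith)

end Scheme

end PauliLearning

end

theorem theorem1_general {ε₀ κ : ℝ} (hε₀ : ε₀ < 1) (hκ : κ ≤ (1 - ε₀) / 18) :
    (∀ (n m : ℕ) (S : PauliLearning.Scheme n m)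
      (est : S.Outcome → PauliLearning.PauliIdx n → ℝ) (ε : ℝ),
      0 < ε → ε ≤ ε₀ → S.Learns est ε →
        κ * (((4 : ℝ) ^ n - 1) / (2 ^ n * ε ^ 2)) ≤ (S.numMeas : ℝ) ∧
        S.numMeas ≤ S.numCopies ∧
        κ * (((4 : ℝ) ^ n - 1) / (2 ^ n * ε ^ 2)) ≤ (S.numCopies : ℝ)) ∧
    (∃ c : ℝ, 0 < c ∧
      ∀ (n m : ℕ) (S : PauliLearning.Scheme n m)
        (est : S.Outcome → PauliLearning.PauliIdx n → ℝ) (ε : ℝ),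
        1 ≤ n → 0 < ε → ε ≤ ε₀ → S.Learns est ε →
          c * (2 ^ n / ε ^ 2) ≤ (S.numMeas : ℝ) ∧
          c * (2 ^ n / ε ^ 2) ≤ (S.numCopies : ℝ)) := by
  have hcopies (n m : ℕ) (S : PauliLearning.Scheme n m) : (S.numMeas : ℝ) ≤ S.numCopies :=
    Nat.cast_le.mpr S.numMeas_le_numCopies
  refine ⟨fun n m S est ε hε hε' hS => ?_, 3 / 4 * ((1 - ε₀) / 18), by linarith,
    fun n m S est ε hn hε hε' hS => ?_⟩
  · have h := hS.mul_le_numMeas hε hε' hε₀ hκ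
    exact ⟨h, S.numMeas_le_numCopies, h.trans (hcopies n m S)⟩
  · have h := hS.mul_two_pow_div_le_numMeas hn hε hε' hε₀
    exact ⟨h, h.trans (hcopies n m S)⟩

theorem theorem1 :
    (∀ (n m : ℕ) (S : PauliLearning.Scheme n m)
      (est : S.Outcome → PauliLearning.PauliIdx n → ℝ) (ε : ℝ),
      0 < ε → ε ≤ 1 / 6 → S.Learns est ε →
        0.005 * (((4 : ℝ) ^ n - 1) / (2 ^ n * ε ^ 2)) ≤ (S.numMeas : ℝ) ∧
        S.numMeas ≤ S.numCopies ∧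
        0.005 * (((4 : ℝ) ^ n - 1) / (2 ^ n * ε ^ 2)) ≤ (S.numCopies : ℝ)) ∧
    (∃ c : ℝ, 0 < c ∧
      ∀ (n m : ℕ) (S : PauliLearning.Scheme n m)
        (est : S.Outcome → PauliLearning.PauliIdx n → ℝ) (ε : ℝ),
        1 ≤ n → 0 < ε → ε ≤ 1 / 6 → S.Learns est ε →
          c * (2 ^ n / ε ^ 2) ≤ (S.numMeas : ℝ) ∧
          c * (2 ^ n / ε ^ 2) ≤ (S.numCopies : ℝ)) :=
  theorem1_general (by norm_num) (by norm_num)
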